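/- Let $(X,\Sigma,\mu)$ be a $\sigma$-finite measure space, let $\mathcal A\subseteq\Sigma$ be a $\sigma$-subalgebra such that $\mu|_{\mathcal A}$ is $\sigma$-finite, and let $E=E^{\mathcal A}$ be the corresponding conditional expectation. It is defined for every measurable $f:X\to[0,\infty]$ (with values in $[0,\infty]$) and for every conditionable $f$, that is, every measurable $f:X\to\mathbb C$ with $E(|f|)<\infty$ almost everywhere. Let $u,w:X\to\mathbb C$ be conditionable. The weighted conditional type (WCT) operator $T=M_wEM_u$ in the complex Hilbert space $L^2(\mu)=L^2(X,\Sigma,\mu)$ is $Tf=wE(uf)$, with domain $\mathcal D(T)$ the set of all $f\in L^2(\mu)$ such that $uf$ is conditionable and $wE(uf)\in L^2(\mu)$. Suppose that $T$ is densely defined, and that the measure space satisfies the condition ($\star$) for every increasing sequence $(X_n)_{n\in\mathbb N}$ in $\Sigma$ with $\mu(X_n)<\infty$ for all $n$ and $X=\bigcup_n X_n$, and every $A\in\Sigma$ with $\mu(A)<\infty$, there is an $n$ such that $A\subseteq X_n$ up to a $\mu$-null set. Then the range $\mathcal R(T)=\{Tf: f\in\mathcal D(T)\}$ is closed in $L^2(\mu)$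 if and only if there is an $r>0$ such that $$E(|u|^2)\,E(|w|^2)\ \ge\ r\qquad \mu\text{-almost everywhere on } S,$$ where $S=\{E(|u|^2)\neq 0\}\cap\{E(|w|^2)\ne 0\}$ is the set on which the product does not vanish. -/

import Mathlib

open MeasureTheory Filter
open scoped ENNReal

noncomputable section

namespace WCT

variable {X : Type*} {m m₀ : MeasurableSpace X}

/-- Conditional expectation of a real function, as the difference of the conditional expectations
of its positive and negative parts (Mathlib's `condLExp` is the Radon-Nikodym conditional
expectation of `[0, ∞]`-valued functions; Mathlib's `condExp` is restricted to integrable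
functions, which is too narrow on an infinite measure space). -/
def condReal (m : MeasurableSpace X) {m₀ : MeasurableSpace X} (μ : Measure X) (f : X → ℝ) :
    X → ℝ :=
  fun x => (condLExp m μ (fun y => ENNReal.ofReal (f y)) x).toReal
    - (condLExp m μ (fun y => ENNReal.ofReal (-f y)) x).toReal

/-- Conditional expectation `E(f)` of a complex function. It is meaningful for conditionable
`f`. -/
def condE (m : MeasurableSpace X) {m₀ : MeasurableSpace X} (μ : Measure X) (f : X → ℂ) : X → ℂ :=
  fun x => ((condReal m μ (fun y => (f y).re) x : ℝ) : ℂ)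
    + ((condReal m μ (fun y => (f y).im) x : ℝ) : ℂ) * Complex.I

/-- `f` is conditionable: it is (a.e.) measurable and `E(|f|)` is finite almost everywhere. -/
def Conditionable (m : MeasurableSpace X) {m₀ : MeasurableSpace X} (μ : Measure X)
    (f : X → ℂ) : Prop :=
  AEStronglyMeasurable f μ ∧ ∀ᵐ x ∂μ, condLExp m μ (fun y => ‖f y‖ₑ) x < ∞

/-- `E(|f|²)` as a `[0, ∞]`-valued function. -/
def condSq (m : MeasurableSpace X) {m₀ : MeasurableSpace X} (μ : Measure X) (f : X → ℂ) :
    X → ℝ≥0∞ :=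
  condLExp m μ (fun y => ‖f y‖ₑ ^ 2)

/-- Condition (⋆): for every increasing sequence of measurable sets of finite measure that
exhausts the space, every measurable set of finite measure is contained, up to a null set, in one
of them. -/
def Star {m₀ : MeasurableSpace X} (μ : Measure X) : Prop :=
  ∀ B : ℕ → Set X, (∀ n, MeasurableSet (B n)) → Monotone B → (∀ n, μ (B n) < ∞) →
    (⋃ n, B n) = Set.univ →
    ∀ A : Set X, MeasurableSet A → μ A < ∞ → ∃ n, A ≤ᵐ[μ] B n

lemma condLExp_lt_top_of_le {μ : Measure X} {f g : X → ℝ≥0∞}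
    (hg : ∀ᵐ x ∂μ, condLExp m μ g x < ∞) (h : ∀ x, f x ≤ g x) :
    ∀ᵐ x ∂μ, condLExp m μ f x < ∞ := by
  filter_upwards [hg, condLExp_mono (mΩ := m) (P := μ) (ae_of_all _ h)] with x h1 h2
  exact h2.trans_lt h1

/-- The real functions to which `condReal` is applied. -/
def CondFinite (m : MeasurableSpace X) {m₀ : MeasurableSpace X} (μ : Measure X) (f : X → ℝ) : Prop :=
  AEMeasurable f μ ∧ ∀ᵐ x ∂μ, condLExp m μ (fun y => ‖f y‖ₑ) x < ∞

lemma CondFinite.pos {μ : Measure X} {f : X → ℝ} (h : CondFinite m μ f) :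
    ∀ᵐ x ∂μ, condLExp m μ (fun y => ENNReal.ofReal (f y)) x < ∞ := by
  refine condLExp_lt_top_of_le h.2 fun x => ?_
  exact Real.ofReal_le_enorm _

lemma CondFinite.neg {μ : Measure X} {f : X → ℝ} (h : CondFinite m μ f) : CondFinite m μ (fun x => -f x) :=
  ⟨h.1.neg, by simpa using h.2⟩

lemma CondFinite.add {μ : Measure X} {f g : X → ℝ} (hf : CondFinite m μ f) (hg : CondFinite m μ g) :
    CondFinite m μ (fun x => f x + g x) := by
  refine ⟨hf.1.add hg.1, ?_⟩
  have h1 := condLExp_add_left (mΩ := m) (P := μ) (fun y => ‖g y‖ₑ) hf.1.enorm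
  have h2 : ∀ᵐ x ∂μ, condLExp m μ ((fun y => ‖f y‖ₑ) + fun y => ‖g y‖ₑ) x < ∞ := by
    filter_upwards [h1, hf.2, hg.2] with x e a b
    rw [e]
    exact ENNReal.add_lt_top.2 ⟨a, b⟩
  exact condLExp_lt_top_of_le h2 fun x => enorm_add_le _ _

lemma CondFinite.smul {μ : Measure X} {f : X → ℝ} (c : ℝ) (hf : CondFinite m μ f) :
    CondFinite m μ (fun x => c * f x) := by
  refine ⟨hf.1.const_mul c, ?_⟩
  have h1 := condLExp_smul (mΩ := m) (P := μ) (fun y => ‖f y‖ₑ) hf.1.enorm ‖c‖ₑ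
  have h2 : ∀ᵐ x ∂μ, condLExp m μ (‖c‖ₑ • fun y => ‖f y‖ₑ) x < ∞ := by
    filter_upwards [h1, hf.2] with x e a
    rw [e]
    exact ENNReal.mul_lt_top enorm_lt_top a
  exact condLExp_lt_top_of_le h2 fun x => by simp [enorm_mul]

lemma condReal_neg {μ : Measure X} (f : X → ℝ) (x : X) :
    condReal m μ (fun y => -f y) x = -condReal m μ f x := by
  simp [condReal]

lemma condReal_add {μ : Measure X} {f g : X → ℝ} (hf : CondFinite m μ f) (hg : CondFinite m μ g) :
    ∀ᵐ x ∂μ, condReal m μ (fun y => f y + g y) x = condReal m μ f x + condReal m μ g x := by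
  set P : (X → ℝ) → X → ℝ≥0∞ := fun f y => ENNReal.ofReal (f y) with hP
  have key : P (fun y => f y + g y) + (P (fun y => -f y) + P (fun y => -g y))
      = P (fun y => -(f y + g y)) + (P f + P g) := by
    funext y
    simp only [hP, Pi.add_apply]
    have e : ∀ t : ℝ, ENNReal.ofReal t = ENNReal.ofReal (max t 0) := fun t => by
      rcases le_total t 0 with h | h <;> simp [h, ENNReal.ofReal_of_nonpos]
    rw [e (f y + g y), e (-f y), e (-g y), e (-(f y + g y)), e (f y), e (g y)]
    rw [← ENNReal.ofReal_add (by positivity) (by positivity),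
      ← ENNReal.ofReal_add (by positivity) (by positivity),
      ← ENNReal.ofReal_add (by positivity) (by positivity),
      ← ENNReal.ofReal_add (by positivity) (by positivity)]
    congr 1
    have k : ∀ t : ℝ, max t 0 = t + max (-t) 0 := fun t => by
      rcases le_total t 0 with h | h <;> simp [h]
    rw [k (f y + g y), k (f y), k (g y)]
    ring
  have mP : ∀ {h : X → ℝ}, AEMeasurable h μ → AEMeasurable (P h) μ := fun h => h.ennreal_ofReal
  have a1 := condLExp_add_left (mΩ := m) (P (fun y => -f y) + P (fun y => -g y))
    (mP (hf.add hg).1)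
  have a2 := condLExp_add_left (mΩ := m) (P (fun y => -g y)) (mP hf.neg.1)
  have a3 := condLExp_add_left (mΩ := m) (P f + P g) (mP (hf.add hg).neg.1)
  have a4 := condLExp_add_left (mΩ := m) (P g) (mP hf.1)
  filter_upwards [a1, a2, a3, a4, hf.pos, hg.pos, hf.neg.pos, hg.neg.pos, (hf.add hg).pos,
    (hf.add hg).neg.pos] with x a1 a2 a3 a4 b1 b2 b3 b4 b5 b6
  rw [key] at a1
  rw [a3] at a1
  simp only [Pi.add_apply] at a1 a2 a4
  rw [a2, a4] at a1
  have a5 := congrArg ENNReal.toReal a1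
  have c {a b c : ℝ≥0∞} (ha : a < ∞) (hb : b < ∞) (hc : c < ∞) :
      (a + (b + c)).toReal = a.toReal + (b.toReal + c.toReal) := by
    rw [ENNReal.toReal_add ha.ne (ENNReal.add_lt_top.2 ⟨hb, hc⟩).ne,
      ENNReal.toReal_add hb.ne hc.ne]
  rw [c b6 b1 b2, c b5 b3 b4] at a5
  simp only [condReal]
  linarith

lemma condReal_smul {μ : Measure X} {f : X → ℝ} (c : ℝ) (hf : CondFinite m μ f) :
    ∀ᵐ x ∂μ, condReal m μ (fun y => c * f y) x = c * condReal m μ f x := by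
  have nonneg : ∀ c : ℝ, 0 ≤ c →
      ∀ᵐ x ∂μ, condReal m μ (fun y => c * f y) x = c * condReal m μ f x := by
    intro c hc
    have s (h : X → ℝ) (hh : AEMeasurable h μ) :=
      condLExp_smul (mΩ := m) (fun y => ENNReal.ofReal (h y)) hh.ennreal_ofReal
        (ENNReal.ofReal c)
    have e (h : X → ℝ) : (ENNReal.ofReal c • fun y => ENNReal.ofReal (h y))
        = fun y => ENNReal.ofReal (c * h y) := by
      funext y; simp [ENNReal.ofReal_mul hc]
    filter_upwards [s f hf.1, s _ hf.neg.1] with x h1 h2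
    rw [e] at h1 h2
    simp only [condReal, ← mul_neg]
    rw [h1, h2]
    simp [ENNReal.toReal_ofReal hc, mul_sub]
  rcases le_total 0 c with hc | hc
  · exact nonneg c hc
  · filter_upwards [nonneg (-c) (by linarith)] with x hx
    have e : (fun y => c * f y) = fun y => -(-c * f y) := by funext y; ring
    rw [e, condReal_neg, hx]
    ring

lemma Conditionable.re {μ : Measure X} {f : X → ℂ} (hf : Conditionable m μ f) :
    CondFinite m μ (fun x => (f x).re) := by
  refine ⟨Complex.measurable_re.comp_aemeasurable hf.1.aemeasurable,
    condLExp_lt_top_of_le hf.2 fun x => ?_⟩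
  rw [enorm_le_iff_norm_le]
  exact Complex.abs_re_le_norm _

lemma Conditionable.im {μ : Measure X} {f : X → ℂ} (hf : Conditionable m μ f) :
    CondFinite m μ (fun x => (f x).im) := by
  refine ⟨Complex.measurable_im.comp_aemeasurable hf.1.aemeasurable,
    condLExp_lt_top_of_le hf.2 fun x => ?_⟩
  rw [enorm_le_iff_norm_le]
  exact Complex.abs_im_le_norm _

lemma Conditionable.congr {μ : Measure X} {f g : X → ℂ} (hf : Conditionable m μ f)
    (h : f =ᵐ[μ] g) : Conditionable m μ g := by
  refine ⟨hf.1.congr h, ?_⟩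
  have e : (fun y => ‖f y‖ₑ) =ᵐ[μ] fun y => ‖g y‖ₑ := by
    filter_upwards [h] with x hx
    rw [hx]
  filter_upwards [hf.2, condLExp_congr_ae (mΩ := m) e] with x h1 h2
  rwa [← h2]

lemma Conditionable.add {μ : Measure X} {f g : X → ℂ} (hf : Conditionable m μ f)
    (hg : Conditionable m μ g) : Conditionable m μ (fun x => f x + g x) := by
  refine ⟨hf.1.add hg.1, ?_⟩
  have h1 := condLExp_add_left (mΩ := m) (P := μ) (fun y => ‖g y‖ₑ) hf.1.enorm
  have h2 : ∀ᵐ x ∂μ, condLExp m μ ((fun y => ‖f y‖ₑ) + fun y => ‖g y‖ₑ) x < ∞ := by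
    filter_upwards [h1, hf.2, hg.2] with x e a b
    rw [e]
    exact ENNReal.add_lt_top.2 ⟨a, b⟩
  exact condLExp_lt_top_of_le h2 fun x => enorm_add_le _ _

lemma Conditionable.smul {μ : Measure X} {f : X → ℂ} (c : ℂ) (hf : Conditionable m μ f) :
    Conditionable m μ (fun x => c * f x) := by
  refine ⟨hf.1.const_mul c, ?_⟩
  have h1 := condLExp_smul (mΩ := m) (P := μ) (fun y => ‖f y‖ₑ) hf.1.enorm ‖c‖ₑ
  have h2 : ∀ᵐ x ∂μ, condLExp m μ (‖c‖ₑ • fun y => ‖f y‖ₑ) x < ∞ := by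
    filter_upwards [h1, hf.2] with x e a
    rw [e]
    exact ENNReal.mul_lt_top enorm_lt_top a
  exact condLExp_lt_top_of_le h2 fun x => by simp [enorm_mul]

lemma condReal_congr {μ : Measure X} {f g : X → ℝ} (h : f =ᵐ[μ] g) :
    condReal m μ f =ᵐ[μ] condReal m μ g := by
  have e1 : (fun y => ENNReal.ofReal (f y)) =ᵐ[μ] fun y => ENNReal.ofReal (g y) := by
    filter_upwards [h] with x hx
    rw [hx]
  have e2 : (fun y => ENNReal.ofReal (-f y)) =ᵐ[μ] fun y => ENNReal.ofReal (-g y) := by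
    filter_upwards [h] with x hx
    rw [hx]
  filter_upwards [condLExp_congr_ae (mΩ := m) e1, condLExp_congr_ae (mΩ := m) e2] with x h1 h2
  simp only [condReal, h1, h2]

lemma condE_congr {μ : Measure X} {f g : X → ℂ} (h : f =ᵐ[μ] g) :
    condE m μ f =ᵐ[μ] condE m μ g := by
  have e1 : (fun y => (f y).re) =ᵐ[μ] fun y => (g y).re := by
    filter_upwards [h] with x hx
    rw [hx]
  have e2 : (fun y => (f y).im) =ᵐ[μ] fun y => (g y).im := by
    filter_upwards [h] with x hx
    rw [hx]
  filter_upwards [condReal_congr (m := m) e1, condReal_congr (m := m) e2] with x h1 h2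
  simp only [condE, h1, h2]

lemma condE_add {μ : Measure X} {f g : X → ℂ} (hf : Conditionable m μ f)
    (hg : Conditionable m μ g) :
    ∀ᵐ x ∂μ, condE m μ (fun y => f y + g y) x = condE m μ f x + condE m μ g x := by
  filter_upwards [condReal_add hf.re hg.re, condReal_add hf.im hg.im] with x h1 h2
  simp only [condE, Complex.add_re, Complex.add_im, h1, h2]
  push_cast
  ring

lemma condE_smul {μ : Measure X} {f : X → ℂ} (c : ℂ) (hf : Conditionable m μ f) :
    ∀ᵐ x ∂μ, condE m μ (fun y => c * f y) x = c * condE m μ f x := by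
  have r := hf.re
  have i := hf.im
  filter_upwards [condReal_smul c.re r, condReal_smul c.re i, condReal_smul c.im r,
    condReal_smul (-c.im) i, condReal_add (r.smul c.re) (i.smul (-c.im)),
    condReal_add (i.smul c.re) (r.smul c.im)] with x h1 h2 h3 h4 h5 h6
  have e1 : (fun y => (c * f y).re) = fun y => c.re * (f y).re + -c.im * (f y).im := by
    funext y; rw [Complex.mul_re]; ring
  have e2 : (fun y => (c * f y).im) = fun y => c.re * (f y).im + c.im * (f y).re := by
    funext y; rw [Complex.mul_im]
  simp only [condE]
  rw [e1, e2, h5, h6, h1, h2, h3, h4]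
  apply Complex.ext
  · simp
    ring
  · simp

/-- The function `w E(u f)`. -/
def apply (m : MeasurableSpace X) {m₀ : MeasurableSpace X} (μ : Measure X) (w u : X → ℂ)
    (f : X → ℂ) : X → ℂ :=
  fun x => w x * condE m μ (fun y => u y * f y) x

lemma apply_add {μ : Measure X} {w u : X → ℂ} {f g : Lp ℂ 2 μ}
    (hf : Conditionable m μ (fun x => u x * f x)) (hg : Conditionable m μ (fun x => u x * g x)) :
    Conditionable m μ (fun x => u x * (f + g : Lp ℂ 2 μ) x) ∧
      apply m μ w u f + apply m μ w u g =ᵐ[μ] apply m μ w u (f + g : Lp ℂ 2 μ) := by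
  have e : (fun x => u x * f x + u x * g x) =ᵐ[μ] fun x => u x * (f + g : Lp ℂ 2 μ) x := by
    filter_upwards [Lp.coeFn_add f g] with x hx
    rw [hx, Pi.add_apply, mul_add]
  refine ⟨(hf.add hg).congr e, ?_⟩
  filter_upwards [condE_congr (m := m) e, condE_add hf hg] with x h1 h2
  simp only [apply, Pi.add_apply]
  rw [← h1, h2, mul_add]

lemma apply_smul {μ : Measure X} {w u : X → ℂ} {f : Lp ℂ 2 μ} (c : ℂ)
    (hf : Conditionable m μ (fun x => u x * f x)) :
    Conditionable m μ (fun x => u x * (c • f : Lp ℂ 2 μ) x) ∧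
      c • apply m μ w u f =ᵐ[μ] apply m μ w u (c • f : Lp ℂ 2 μ) := by
  have e : (fun x => c * (u x * f x)) =ᵐ[μ] fun x => u x * (c • f : Lp ℂ 2 μ) x := by
    filter_upwards [Lp.coeFn_smul c f] with x hx
    rw [hx, Pi.smul_apply, smul_eq_mul]
    ring
  refine ⟨(hf.smul c).congr e, ?_⟩
  filter_upwards [condE_congr (m := m) e, condE_smul c hf] with x h1 h2
  simp only [apply, Pi.smul_apply, smul_eq_mul]
  rw [← h1, h2]
  ring

/-- The maximal domain of `M_w E M_u` in `L²(μ)`: all `f ∈ L²(μ)` such that `u f` is conditionable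
and `w E(u f) ∈ L²(μ)`. -/
def domain (m : MeasurableSpace X) {m₀ : MeasurableSpace X} (μ : Measure X) (w u : X → ℂ) :
    Submodule ℂ (Lp ℂ 2 μ) where
  carrier := {f | Conditionable m μ (fun x => u x * f x) ∧ MemLp (apply m μ w u f) 2 μ}
  add_mem' := fun {_ _} hf hg =>
    ⟨(apply_add (w := w) hf.1 hg.1).1, (hf.2.add hg.2).ae_eq (apply_add hf.1 hg.1).2⟩
  zero_mem' := by
    have e : (fun _ : X => (0 : ℂ)) =ᵐ[μ] fun x => u x * (0 : Lp ℂ 2 μ) x := by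
      filter_upwards [Lp.coeFn_zero ℂ 2 μ] with x hx
      rw [hx]
      simp
    have h0 : (condLExp m μ fun _ : X => (0 : ℝ≥0∞)) = 0 := condLExp_zero μ
    refine ⟨Conditionable.congr ⟨aestronglyMeasurable_const, ?_⟩ e, ?_⟩
    · simp [h0]
    · refine (MemLp.zero (ε := ℂ)).ae_eq ?_
      filter_upwards [condE_congr (m := m) e] with x hx
      simp only [apply]
      rw [← hx]
      simp [condE, condReal, h0]
  smul_mem' := fun c _ hf =>
    ⟨(apply_smul (w := w) c hf.1).1, (hf.2.const_smul c).ae_eq (apply_smul c hf.1).2⟩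

/-- The weighted conditional type operator `M_w E M_u : f ↦ w E(u f)`, as an unbounded linear
operator in `L²(μ)` with its maximal domain. -/
def op (m : MeasurableSpace X) {m₀ : MeasurableSpace X} (μ : Measure X) (w u : X → ℂ) :
    Lp ℂ 2 μ →ₗ.[ℂ] Lp ℂ 2 μ where
  domain := domain m μ w u
  toFun :=
    { toFun := fun f => f.2.2.toLp (apply m μ w u (f : Lp ℂ 2 μ))
      map_add' := fun f g => by
        rw [← MemLp.toLp_add f.2.2 g.2.2]
        exact MemLp.toLp_congr _ _ (apply_add f.2.1 g.2.1).2.symm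
      map_smul' := fun c f => by
        rw [RingHom.id_apply, ← MemLp.toLp_const_smul c f.2.2]
        exact MemLp.toLp_congr _ _ (apply_smul c f.2.1).2.symm }

end WCT

end

namespace WCT

variable {X : Type*} {m m₀ : MeasurableSpace X}

/-! Write F = E(|u|²) and G = E(|w|²). The condition (⋆) makes every measurable function essentially
bounded on sets of finite measure, so F and G are finite a.e. The range consists of functions wh
with h measurable for the subalgebra, and two weighted norms of h compete. On one side ‖wh‖² = ∫
|h|² G. On the other, wh ∈ L² lies in the range as soon as ∫ |h|²/F < ∞, with preimage ū h/F
(`mem_range_op_of_lintegral`), while h = E(uf) always satisfies ∫ |h|²/F ≤ 16 ‖f‖² by conditional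
Cauchy-Schwarz (`sq_condE_div_le`). Closedness thus amounts to 1/F ≤ C·G on S, that is, FG ≥ 1/C.

If FG ≥ r on S, a limit of elements of the range is again some wh with h supported in S, and ∫
|h|²/F ≤ r⁻¹ ∫ |h|² G < ∞. If the range is closed, truncation puts every wh ∈ L² with h = 0 on {F =
0} in it; taking |h|² = ψ/G shows that ψ/(FG) is integrable for every integrable ψ supported in S
and measurable for the subalgebra. A series of indicators of sets on which FG < 2⁻ᵏ violates this
unless FG is bounded below on S. -/

/-! ### Pulling measurable factors out of E, and supports. -/

lemma lintegral_mul_condLExp (hm : m ≤ m₀) (μ : Measure X) [SigmaFinite (μ.trim hm)]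
    {φ f : X → ℝ≥0∞} (hφ : Measurable[m] φ) (hf : AEMeasurable f μ) :
    ∫⁻ x, φ x * condLExp m μ f x ∂μ = ∫⁻ x, φ x * f x ∂μ := by
  have hE := measurable_condLExp m μ f
  -- On the subalgebra the measure f·μ has density E(f); no finiteness of f is needed.
  have e : (μ.withDensity f).trim hm = (μ.trim hm).withDensity (condLExp m μ f) := by
    refine @Measure.ext _ m _ _ fun s hs => ?_
    rw [trim_measurableSet_eq hm hs, withDensity_apply _ (hm s hs), withDensity_apply _ hs,
      setLIntegral_condLExp_trim hm μ f hs]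
  calc ∫⁻ x, φ x * condLExp m μ f x ∂μ
      = ∫⁻ x, (condLExp m μ f * φ) x ∂(μ.trim hm) := by
        rw [lintegral_trim hm (hE.mul hφ)]
        simp only [Pi.mul_apply, mul_comm]
    _ = ∫⁻ x, φ x ∂(μ.withDensity f) := by
        rw [← lintegral_withDensity_eq_lintegral_mul _ hE hφ, ← e, lintegral_trim hm hφ]
    _ = ∫⁻ x, φ x * f x ∂μ := by
        rw [lintegral_withDensity_eq_lintegral_mul₀ hf (hφ.mono hm le_rfl).aemeasurable]
        simp only [Pi.mul_apply, mul_comm]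

lemma condLExp_mul (hm : m ≤ m₀) (μ : Measure X) [SigmaFinite (μ.trim hm)]
    {φ f : X → ℝ≥0∞} (hφ : Measurable[m] φ) (hf : AEMeasurable f μ) :
    condLExp m μ (fun x => φ x * f x) =ᵐ[μ] fun x => φ x * condLExp m μ f x := by
  refine (ae_eq_condLExp hm μ _ (hφ.mul (measurable_condLExp m μ f)) fun s hs => ?_).symm
  rw [← lintegral_indicator (hm s hs), ← lintegral_indicator (hm s hs)]
  have h := lintegral_mul_condLExp hm μ (hφ.indicator hs) hf
  simp only [← Set.indicator_mul_left] at h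
  exact h

lemma condSq_mul (hm : m ≤ m₀) (μ : Measure X) [SigmaFinite (μ.trim hm)] {u : X → ℂ}
    (hu : AEStronglyMeasurable u μ) {φ : X → ℝ≥0∞} (hφ : Measurable[m] φ) :
    condLExp m μ (fun x => φ x * ‖u x‖ₑ ^ 2) =ᵐ[μ] fun x => φ x * condSq m μ u x :=
  condLExp_mul hm μ hφ (hu.enorm.pow_const 2)

lemma lintegral_mul_condSq (hm : m ≤ m₀) (μ : Measure X) [SigmaFinite (μ.trim hm)] {u : X → ℂ}
    (hu : AEStronglyMeasurable u μ) {φ : X → ℝ≥0∞} (hφ : Measurable[m] φ) :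
    ∫⁻ x, φ x * condSq m μ u x ∂μ = ∫⁻ x, φ x * ‖u x‖ₑ ^ 2 ∂μ :=
  lintegral_mul_condLExp hm μ hφ (hu.enorm.pow_const 2)

lemma measurable_condSq (m : MeasurableSpace X) {m₀ : MeasurableSpace X} (μ : Measure X)
    (u : X → ℂ) : Measurable[m] (condSq m μ u) :=
  measurable_condLExp m μ _

/-- A set of the subalgebra that almost contains the support of `u` almost contains the support
of `E(|u|²)`. -/
lemma ae_mem_of_condSq_ne_zero (hm : m ≤ m₀) (μ : Measure X) [SigmaFinite (μ.trim hm)]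
    {u : X → ℂ} (hu : AEStronglyMeasurable u μ) {D : Set X} (hD : MeasurableSet[m] D)
    (h : ∀ᵐ x ∂μ, u x ≠ 0 → x ∈ D) : ∀ᵐ x ∂μ, condSq m μ u x ≠ 0 → x ∈ D := by
  have hφ : Measurable[m] (Dᶜ.indicator fun _ => (1 : ℝ≥0∞)) :=
    Measurable.indicator measurable_const hD.compl
  have i := lintegral_mul_condSq hm μ hu hφ
  have z : ∫⁻ x, Dᶜ.indicator (fun _ => (1 : ℝ≥0∞)) x * ‖u x‖ₑ ^ 2 ∂μ = 0 := by
    rw [lintegral_congr_ae (g := fun _ => 0), lintegral_zero]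
    filter_upwards [h] with x hx
    by_cases k : u x = 0
    · simp [k]
    · simp [hx k]
  rw [z] at i
  filter_upwards [(lintegral_eq_zero_iff
    ((hφ.mul (measurable_condSq m μ u)).mono hm le_rfl)).1 i] with x hx hne
  by_contra k
  simp [k, hne] at hx

/-- Test ∫ φ E(|u|²) = ∫ φ |u|² with φ the indicator of {E(|u|²) = 0}. -/
lemma ae_eq_zero_of_condSq_eq_zero (hm : m ≤ m₀) (μ : Measure X) [SigmaFinite (μ.trim hm)]
    {u : X → ℂ} (hu : AEStronglyMeasurable u μ) :
    ∀ᵐ x ∂μ, condSq m μ u x = 0 → u x = 0 := by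
  have hD : MeasurableSet[m] {x | condSq m μ u x = 0} :=
    measurable_condSq m μ u (measurableSet_singleton 0)
  have hφ : Measurable[m] ({x | condSq m μ u x = 0}.indicator fun _ => (1 : ℝ≥0∞)) :=
    Measurable.indicator measurable_const hD
  have i := lintegral_mul_condSq hm μ hu hφ
  have z : ∫⁻ x, {x | condSq m μ u x = 0}.indicator (fun _ => (1 : ℝ≥0∞)) x *
      condSq m μ u x ∂μ = 0 := by
    rw [lintegral_congr (g := fun _ => 0), lintegral_zero]
    intro x
    by_cases k : condSq m μ u x = 0 <;> simp [k]
  rw [z] at i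
  filter_upwards [(lintegral_eq_zero_iff'
    ((hφ.mono hm le_rfl).aemeasurable.mul (hu.enorm.pow_const 2))).1 i.symm] with x hx h0
  simpa [h0] using hx

/-- Both parts of t factor out of E, and `ENNReal.toReal` is multiplicative even at ∞, so neither
integrability nor finiteness of E(|u|²) enters. -/
lemma condReal_sq_mul (hm : m ≤ m₀) (μ : Measure X) [SigmaFinite (μ.trim hm)] {u : X → ℂ}
    (hu : AEStronglyMeasurable u μ) {t : X → ℝ} (ht : Measurable[m] t) :
    condReal m μ (fun x => ‖u x‖ ^ 2 * t x) =ᵐ[μ] fun x => (condSq m μ u x).toReal * t x := by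
  have e (s : X → ℝ) : (fun x => ENNReal.ofReal (‖u x‖ ^ 2 * s x))
      = fun x => ENNReal.ofReal (s x) * ‖u x‖ₑ ^ 2 := by
    funext x
    rw [ENNReal.ofReal_mul (by positivity), ENNReal.ofReal_pow (norm_nonneg _), ofReal_norm,
      mul_comm]
  filter_upwards [condSq_mul hm μ hu ht.ennreal_ofReal,
    condSq_mul hm μ hu ht.neg.ennreal_ofReal] with x h1 h2
  simp only [condReal, ← mul_neg]
  rw [e t, e fun x => -t x, h1]
  erw [h2]
  rw [ENNReal.toReal_mul, ENNReal.toReal_mul, ENNReal.toReal_ofReal', Pi.neg_apply,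
    ENNReal.toReal_ofReal', ← sub_mul, mul_comm]
  congr 1
  rcases le_total (t x) 0 with h | h <;> simp [h]

lemma condE_sq_mul (hm : m ≤ m₀) (μ : Measure X) [SigmaFinite (μ.trim hm)] {u : X → ℂ}
    (hu : AEStronglyMeasurable u μ) {t : X → ℂ} (ht : Measurable[m] t) :
    condE m μ (fun x => ((‖u x‖ ^ 2 : ℝ) : ℂ) * t x)
      =ᵐ[μ] fun x => ((condSq m μ u x).toReal : ℂ) * t x := by
  filter_upwards [condReal_sq_mul hm μ hu (Complex.measurable_re.comp ht),
    condReal_sq_mul hm μ hu (Complex.measurable_im.comp ht)] with x h1 h2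
  simp only [condE, Complex.re_ofReal_mul, Complex.im_ofReal_mul]
  simp only [Function.comp_apply] at h1 h2
  rw [h1, h2]
  apply Complex.ext <;> simp

lemma measurable_condReal (m : MeasurableSpace X) {m₀ : MeasurableSpace X} (μ : Measure X)
    (f : X → ℝ) : Measurable[m] (condReal m μ f) :=
  (measurable_condLExp m μ _).ennreal_toReal.sub (measurable_condLExp m μ _).ennreal_toReal

lemma measurable_condE (m : MeasurableSpace X) {m₀ : MeasurableSpace X} (μ : Measure X)
    (f : X → ℂ) : Measurable[m] (condE m μ f) :=
  (Complex.measurable_ofReal.comp (measurable_condReal m μ _)).add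
    ((Complex.measurable_ofReal.comp (measurable_condReal m μ _)).mul_const _)

/-- Positive and negative part are each dominated by |g|, whence the crude constant 2; real and
imaginary part then give 4 in `enorm_condE_le`. Only finiteness of integrals matters later, so sharp
constants are not needed. -/
lemma enorm_condReal_le (μ : Measure X) {f : X → ℝ} {g : X → ℂ} (h : ∀ x, |f x| ≤ ‖g x‖) :
    ∀ᵐ x ∂μ, ‖condReal m μ f x‖ₑ ≤ 2 * condLExp m μ (fun y => ‖g y‖ₑ) x := by
  have k (x : X) (s : ℝ) (hs : s ≤ |f x|) : ENNReal.ofReal s ≤ ‖g x‖ₑ := by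
    rw [← ofReal_norm]
    exact ENNReal.ofReal_le_ofReal (hs.trans (h x))
  have e (a : ℝ≥0∞) : ‖a.toReal‖ₑ ≤ a := by
    rw [Real.enorm_of_nonneg ENNReal.toReal_nonneg]
    exact ENNReal.ofReal_toReal_le
  filter_upwards [condLExp_mono (mΩ := m) (P := μ) (ae_of_all _ fun x => k x (f x) (le_abs_self _)),
    condLExp_mono (mΩ := m) (P := μ) (ae_of_all _ fun x => k x (-f x) (neg_le_abs _))] with x h1 h2
  rw [two_mul]
  exact (enorm_sub_le).trans (add_le_add ((e _).trans h1) ((e _).trans h2))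

lemma enorm_condE_le (μ : Measure X) (f : X → ℂ) :
    ∀ᵐ x ∂μ, ‖condE m μ f x‖ₑ ≤ 4 * condLExp m μ (fun y => ‖f y‖ₑ) x := by
  filter_upwards [enorm_condReal_le (m := m) μ fun x => Complex.abs_re_le_norm (f x),
    enorm_condReal_le (m := m) μ fun x => Complex.abs_im_le_norm (f x)] with x h1 h2
  have e (r : ℝ) : ‖(r : ℂ)‖ₑ = ‖r‖ₑ := by
    rw [← ofReal_norm, ← ofReal_norm, Complex.norm_real]
  refine (enorm_add_le _ _).trans ?_
  rw [enorm_mul, e, e, ← ofReal_norm Complex.I, Complex.norm_I, ENNReal.ofReal_one, mul_one]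
  refine (add_le_add h1 h2).trans_eq ?_
  rw [← add_mul]
  norm_num

/-! ### Conditional Cauchy-Schwarz and finiteness of E(|u|²). -/

/-- A conditional Cauchy-Schwarz inequality. -/
lemma sq_condLExp_mul_div_le (hm : m ≤ m₀) (μ : Measure X) [SigmaFinite (μ.trim hm)]
    {u f : X → ℂ} (hu : AEStronglyMeasurable u μ) (hf : AEStronglyMeasurable f μ)
    (hF : ∀ᵐ x ∂μ, condSq m μ u x < ∞) (hq : ∀ᵐ x ∂μ, condSq m μ f x < ∞)
    (hp : ∀ᵐ x ∂μ, condLExp m μ (fun y => ‖u y * f y‖ₑ) x < ∞) :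
    ∀ᵐ x ∂μ, condLExp m μ (fun y => ‖u y * f y‖ₑ) x ^ 2 / condSq m μ u x ≤ condSq m μ f x := by
  set p := condLExp m μ (fun y => ‖u y * f y‖ₑ) with hpdef
  set F := condSq m μ u with hFdef
  have mp : Measurable[m] p := measurable_condLExp m μ _
  have mF : Measurable[m] F := measurable_condSq m μ u
  have mθ : Measurable[m] fun x => p x / F x := mp.div mF
  have amgm (a b : ℝ≥0∞) : 2 * (a * b) ≤ a ^ 2 + b ^ 2 := by
    rcases eq_or_ne a ∞ with rfl | ha
    · simp
    rcases eq_or_ne b ∞ with rfl | hb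
    · simp
    lift a to NNReal using ha
    lift b to NNReal using hb
    norm_cast
    have := two_mul_le_add_sq a b
    rwa [mul_assoc] at this
  -- The inequality 2ab ≤ a² + b² with a = θ|u|, b = |f|. The factor θ = p/F leaves E and gives 2θp
  -- ≤ θ²F + E(|f|²), for which this θ is optimal.
  have le : ∀ x, 2 * (p x / F x) * ‖u x * f x‖ₑ
      ≤ (p x / F x) ^ 2 * ‖u x‖ₑ ^ 2 + ‖f x‖ₑ ^ 2 := fun x => by
    rw [← mul_pow, enorm_mul, mul_assoc, ← mul_assoc (p x / F x)]
    exact amgm _ _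
  have h1 := condLExp_mono (mΩ := m) (P := μ) (ae_of_all _ le)
  have h2 := condLExp_mul hm μ (mθ.const_mul 2) (hu.mul hf).enorm
  have h3 := condSq_mul hm μ hu (mθ.pow_const 2)
  have h4 := condLExp_add_right (mΩ := m) (P := μ)
    (fun x => (p x / F x) ^ 2 * ‖u x‖ₑ ^ 2) (hf.enorm.pow_const 2)
  filter_upwards [h1, h2, h3, h4, hF, hq, hp] with x h1 h2 h3 h4 hF hq hp
  simp only [Pi.mul_apply] at h2
  rw [h2] at h1
  have h1' := h1.trans_eq h4
  simp only [Pi.add_apply] at h1'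
  rw [h3] at h1'
  change 2 * (p x / F x) * p x ≤ (p x / F x) ^ 2 * F x + condSq m μ f x at h1'
  change p x < ∞ at hp
  -- If F = 0 and p ≠ 0, then θ = ∞: the left side is ∞ while θ²F = ∞ · 0 = 0, contradicting E(|f|²)
  -- < ∞.
  rcases eq_or_ne (F x) 0 with h0 | h0
  · rcases eq_or_ne (p x) 0 with k | k
    · simp [k]
    · exfalso
      rw [h0, ENNReal.div_zero k, ENNReal.mul_top (by norm_num), ENNReal.top_mul k] at h1'
      simp only [mul_zero, zero_add, top_le_iff] at h1'
      exact hq.ne h1'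
  · have e1 : (p x / F x) ^ 2 * F x = p x ^ 2 / F x := by
      rw [sq, mul_assoc, ENNReal.div_mul_cancel h0 hF.ne, sq, div_eq_mul_inv, div_eq_mul_inv]
      ring
    have e2 : 2 * (p x / F x) * p x = p x ^ 2 / F x + p x ^ 2 / F x := by
      rw [div_eq_mul_inv, div_eq_mul_inv]
      ring
    rw [e1, e2] at h1'
    exact ENNReal.le_of_add_le_add_left
      (ENNReal.div_lt_top (ENNReal.pow_lt_top hp).ne h0).ne h1'

/-- Under the exhaustion condition, `E(|u|²)` is finite almost everywhere. -/
lemma Star.condSq_lt_top {μ : Measure X} (hs : Star μ) (hm : m ≤ m₀) [SigmaFinite μ]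
    [SigmaFinite (μ.trim hm)] {u : X → ℂ} (hu : AEStronglyMeasurable u μ) :
    ∀ᵐ x ∂μ, condSq m μ u x < ∞ := by
  set v := hu.mk u with hv
  have mv : Measurable v := hu.stronglyMeasurable_mk.measurable
  have key : ∀ k, ∀ᵐ x ∂μ, x ∈ spanningSets (μ.trim hm) k → condSq m μ u x < ∞ := by
    intro k
    set A := spanningSets (μ.trim hm) k
    have mA : MeasurableSet[m] A := measurableSet_spanningSets (μ.trim hm) k
    -- Apply (⋆) to the sublevel sets of |v|, cut down to finite measure: u is essentially bounded
    -- by n on A. As A belongs to the subalgebra, E(|u|²) ≤ n² there.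
    obtain ⟨n, hn⟩ := hs (fun n => spanningSets μ n ∩ {x | ‖v x‖ ≤ n})
      (fun n => (measurableSet_spanningSets μ n).inter (measurableSet_le mv.norm measurable_const))
      (fun i j hij => Set.inter_subset_inter (monotone_spanningSets μ hij)
        fun x (hx : ‖v x‖ ≤ i) => hx.trans (by exact_mod_cast hij))
      (fun n => (measure_mono Set.inter_subset_left).trans_lt (measure_spanningSets_lt_top μ n))
      (by
        refine Set.eq_univ_of_forall fun x => ?_
        obtain ⟨i, hi⟩ := Set.mem_iUnion.1 ((iUnion_spanningSets μ).ge (Set.mem_univ x))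
        obtain ⟨j, hj⟩ := exists_nat_ge ‖v x‖
        refine Set.mem_iUnion.2 ⟨max i j, monotone_spanningSets μ (le_max_left i j) hi, ?_⟩
        exact hj.trans (by exact_mod_cast le_max_right i j))
      A (hm A mA) (measure_spanningSets_trim_lt_top hm μ k)
    have hφ : Measurable[m] (A.indicator fun _ => (1 : ℝ≥0∞)) :=
      Measurable.indicator measurable_const mA
    have le : (fun x => A.indicator (fun _ => (1 : ℝ≥0∞)) x * ‖u x‖ₑ ^ 2)
        ≤ᵐ[μ] fun _ => ENNReal.ofReal n ^ 2 := by
      filter_upwards [hn, hu.ae_eq_mk] with x hx e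
      by_cases hA : x ∈ A
      · have : ‖v x‖ ≤ n := (hx hA).2
        simp only [hA, Set.indicator_of_mem, one_mul]
        rw [e, ← ofReal_norm]
        gcongr
      · simp [hA]
    filter_upwards [condLExp_mono (mΩ := m) le, condSq_mul hm μ hu hφ] with x h1 h2 hA
    rw [h2, condLExp_const hm] at h1
    simp only [hA, Set.indicator_of_mem, one_mul] at h1
    exact h1.trans_lt (ENNReal.pow_lt_top ENNReal.ofReal_lt_top)
  filter_upwards [ae_all_iff.2 key] with x hx
  obtain ⟨k, hk⟩ := Set.mem_iUnion.1 ((iUnion_spanningSets (μ.trim hm)).ge (Set.mem_univ x))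
  exact hx k hk

/-! ### Membership in the range. -/

lemma memLp_two_iff_lintegral {μ : Measure X} {f : X → ℂ} (hf : AEStronglyMeasurable f μ) :
    MemLp f 2 μ ↔ ∫⁻ x, ‖f x‖ₑ ^ 2 ∂μ < ∞ := by
  have := eLpNorm_lt_top_iff_lintegral_rpow_enorm_lt_top (f := f) (μ := μ) (p := 2)
    (by norm_num) (by norm_num)
  simp only [ENNReal.toReal_ofNat, ENNReal.rpow_ofNat] at this
  exact ⟨fun h => this.1 h.2, fun h => ⟨hf, this.2 h⟩⟩

lemma lintegral_enorm_sq_mul (hm : m ≤ m₀) (μ : Measure X) [SigmaFinite (μ.trim hm)] {w h : X → ℂ}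
    (hw : AEStronglyMeasurable w μ) (hh : Measurable[m] h) :
    ∫⁻ x, ‖w x * h x‖ₑ ^ 2 ∂μ = ∫⁻ x, ‖h x‖ₑ ^ 2 * condSq m μ w x ∂μ := by
  have mh : Measurable[m] fun x => ‖h x‖ₑ := measurable_enorm.comp hh
  rw [lintegral_mul_condSq hm μ hw (mh.pow_const 2)]
  exact lintegral_congr fun x => by rw [enorm_mul, mul_pow, mul_comm]

lemma mem_range_op_iff {μ : Measure X} {w u : X → ℂ} {g : Lp ℂ 2 μ} :
    g ∈ Set.range (op m μ w u) ↔ ∃ f : Lp ℂ 2 μ, Conditionable m μ (fun x => u x * f x) ∧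
      g =ᵐ[μ] apply m μ w u f := by
  constructor
  · rintro ⟨f, rfl⟩
    exact ⟨f, f.2.1, MemLp.coeFn_toLp f.2.2⟩
  · rintro ⟨f, hf, hg⟩
    have hL : MemLp (apply m μ w u f) 2 μ := (Lp.memLp g).ae_eq hg
    refine ⟨⟨f, hf, hL⟩, Lp.ext ?_⟩
    exact (MemLp.coeFn_toLp hL).trans hg.symm

/-- The preimage is f₀ = ū h/F with F = E(|u|²): then E(u f₀) = F · h/F = h and ‖f₀‖² = ∫ |h|²/F. -/
lemma mem_range_op_of_lintegral (hm : m ≤ m₀) (μ : Measure X) [SigmaFinite (μ.trim hm)]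
    {w u : X → ℂ} (hu : AEStronglyMeasurable u μ) (hF : ∀ᵐ x ∂μ, condSq m μ u x < ∞)
    {h : X → ℂ} (hh : Measurable[m] h)
    (hi : ∫⁻ x, ‖h x‖ₑ ^ 2 / condSq m μ u x ∂μ < ∞) {g : Lp ℂ 2 μ}
    (hg : g =ᵐ[μ] fun x => w x * h x) : g ∈ Set.range (op m μ w u) := by
  set F := condSq m μ u with hFdef
  have mF : Measurable[m] F := measurable_condSq m μ u
  have mt : Measurable[m] fun x => h x / ((F x).toReal : ℂ) :=
    hh.div (Complex.measurable_ofReal.comp mF.ennreal_toReal)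
  -- In `ℝ≥0∞`, c/0 = ∞ for c ≠ 0, so the finite integral also encodes that h vanishes where F does.
  have h0 : ∀ᵐ x ∂μ, F x = 0 → h x = 0 := by
    have mh : Measurable[m] fun x => ‖h x‖ₑ := measurable_enorm.comp hh
    have mhF : Measurable[m] fun x => ‖h x‖ₑ ^ 2 / F x := (mh.pow_const 2).div mF
    filter_upwards [ae_lt_top (mhF.mono hm le_rfl) hi.ne] with x hx hF0
    by_contra k
    rw [hF0, ENNReal.div_zero (by simp [k])] at hx
    exact lt_irrefl _ hx
  set f₀ : X → ℂ := fun x => (starRingEnd ℂ) (u x) * (h x / ((F x).toReal : ℂ)) with hf₀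
  have mf₀ : AEStronglyMeasurable f₀ μ :=
    (Complex.continuous_conj.comp_aestronglyMeasurable hu).mul
      (mt.mono hm le_rfl).aestronglyMeasurable
  have hL : MemLp f₀ 2 μ := by
    rw [memLp_two_iff_lintegral mf₀]
    refine lt_of_le_of_lt ?_ hi
    have e : ∀ x, ‖f₀ x‖ₑ ^ 2 = ‖u x * (h x / ((F x).toReal : ℂ))‖ₑ ^ 2 := fun x => by
      simp only [hf₀, enorm_mul, ← ofReal_norm ((starRingEnd ℂ) _), RCLike.norm_conj, ofReal_norm]
    rw [lintegral_congr e, lintegral_enorm_sq_mul hm μ hu mt]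
    refine lintegral_mono_ae ?_
    filter_upwards [hF, h0] with x hx h0
    rcases eq_or_ne (F x) 0 with k | k
    · simp [h0 k]
    have e1 : ‖h x / ((F x).toReal : ℂ)‖ₑ = ‖h x‖ₑ / F x := by
      rw [← ofReal_norm, norm_div, Complex.norm_real, Real.norm_of_nonneg ENNReal.toReal_nonneg,
        ENNReal.ofReal_div_of_pos (ENNReal.toReal_pos k hx.ne), ofReal_norm,
        ENNReal.ofReal_toReal hx.ne]
    rw [e1, sq, mul_assoc, ENNReal.div_mul_cancel k hx.ne, sq, div_eq_mul_inv, div_eq_mul_inv]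
    exact le_of_eq (by ring)
  have e : (fun x => ((‖u x‖ ^ 2 : ℝ) : ℂ) * (h x / ((F x).toReal : ℂ)))
      =ᵐ[μ] fun x => u x * hL.toLp f₀ x := by
    filter_upwards [hL.coeFn_toLp] with x hx
    rw [hx]
    simp only [hf₀]
    rw [← mul_assoc, Complex.mul_conj, Complex.normSq_eq_norm_sq]
  refine mem_range_op_iff.2 ⟨hL.toLp f₀, Conditionable.congr ⟨?_, ?_⟩ e, ?_⟩
  · exact (Complex.measurable_ofReal.comp_aemeasurable
      (hu.norm.aemeasurable.pow_const 2)).aestronglyMeasurable.mul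
        (mt.mono hm le_rfl).aestronglyMeasurable
  · have e2 : (fun x => ‖((‖u x‖ ^ 2 : ℝ) : ℂ) * (h x / ((F x).toReal : ℂ))‖ₑ)
        = fun x => ‖h x / ((F x).toReal : ℂ)‖ₑ * ‖u x‖ₑ ^ 2 := by
      funext x
      rw [enorm_mul, mul_comm, ← ofReal_norm ((‖u x‖ ^ 2 : ℝ) : ℂ), Complex.norm_real,
        Real.norm_of_nonneg (by positivity), ENNReal.ofReal_pow (norm_nonneg _), ofReal_norm]
    rw [e2]
    have mt' : Measurable[m] fun x => ‖h x / ((F x).toReal : ℂ)‖ₑ := measurable_enorm.comp mt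
    filter_upwards [condSq_mul hm μ hu mt', hF] with x h1 h2
    rw [h1]
    exact ENNReal.mul_lt_top enorm_lt_top h2
  · filter_upwards [hg, condE_congr (m := m) e, condE_sq_mul hm μ hu mt, hF, h0]
      with x h1 h2 h3 h4 h5
    rw [h1, apply, ← h2, h3]
    congr 1
    rcases eq_or_ne (F x) 0 with k | k
    · simp [h5 k]
    · rw [mul_div_cancel₀]
      exact_mod_cast (ENNReal.toReal_pos k h4.ne).ne'

lemma condSq_coe_lt_top (μ : Measure X) (f : Lp ℂ 2 μ) : ∀ᵐ x ∂μ, condSq m μ f x < ∞ :=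
  condLExp_lt_top ((memLp_two_iff_lintegral (Lp.aestronglyMeasurable f)).1 (Lp.memLp f)).ne

/-- The counterpart of `mem_range_op_of_lintegral`: integrated, it bounds ∫ |E(uf)|²/E(|u|²) by
16‖f‖². The constant is 4², from `enorm_condE_le`. -/
lemma sq_condE_div_le (hm : m ≤ m₀) (μ : Measure X) [SigmaFinite (μ.trim hm)]
    {u : X → ℂ} (hu : AEStronglyMeasurable u μ) (hF : ∀ᵐ x ∂μ, condSq m μ u x < ∞)
    {f : Lp ℂ 2 μ} (hf : Conditionable m μ fun x => u x * f x) :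
    ∀ᵐ x ∂μ, ‖condE m μ (fun y => u y * f y) x‖ₑ ^ 2 / condSq m μ u x
      ≤ 16 * condSq m μ f x := by
  filter_upwards [enorm_condE_le (m := m) μ fun y => u y * f y,
    sq_condLExp_mul_div_le hm μ hu (Lp.aestronglyMeasurable f) hF (condSq_coe_lt_top μ f) hf.2]
    with x h1 h2
  calc _ ≤ (4 * condLExp m μ (fun y => ‖u y * f y‖ₑ) x) ^ 2 / condSq m μ u x := by gcongr
    _ = 16 * (condLExp m μ (fun y => ‖u y * f y‖ₑ) x ^ 2 / condSq m μ u x) := by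
      rw [mul_pow, mul_div_assoc]
      norm_num
    _ ≤ _ := by gcongr

/-! ### A lower bound implies closed range. -/

lemma measurable_limUnder {_ : MeasurableSpace X} {a : ℕ → X → ℂ}
    (ha : ∀ k, Measurable (a k)) : Measurable fun x => limUnder atTop fun k => a k x :=
  (StronglyMeasurable.limUnder fun k => (ha k).stronglyMeasurable).measurable

lemma measurable_tsum {_ : MeasurableSpace X} {a : ℕ → X → ℝ≥0∞} (ha : ∀ k, Measurable (a k)) :
    Measurable fun x => ∑' k, a k x :=
  Measurable.tsum ha

/-- If `E(|u|²) E(|w|²)` is bounded below on its support, then the range is closed. -/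
lemma isClosed_range_op (hm : m ≤ m₀) (μ : Measure X) [SigmaFinite (μ.trim hm)] {w u : X → ℂ}
    (hw : AEStronglyMeasurable w μ) (hu : AEStronglyMeasurable u μ)
    (hF : ∀ᵐ x ∂μ, condSq m μ u x < ∞) {r : ℝ} (hr : 0 < r)
    (h : ∀ᵐ x ∂μ, condSq m μ u x * condSq m μ w x ≠ 0 →
      ENNReal.ofReal r ≤ condSq m μ u x * condSq m μ w x) :
    IsClosed (Set.range (op m μ w u)) := by
  refine IsSeqClosed.isClosed fun g g₀ hg hlim => ?_
  simp only [mem_range_op_iff] at hg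
  choose f hf hgf using hg
  obtain ⟨ns, -, hns⟩ := (tendstoInMeasure_of_tendsto_Lp hlim).exists_seq_tendsto_ae
  set a : ℕ → X → ℂ := fun k => condE m μ fun y => u y * f (ns k) y with ha
  have ma (k) : Measurable[m] (a k) := measurable_condE m μ _
  -- Almost everywhere, `a k x` can fail to converge only where w = 0; there the default value of b
  -- is harmless, since only w·b matters.
  set b : X → ℂ := fun x => limUnder atTop fun k => a k x with hb
  have mb : Measurable[m] b := measurable_limUnder ma
  -- Cutting b off outside S loses nothing: a.e., if E(|u|²) = 0 then all `a k` vanish, and if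
  -- E(|w|²) = 0 then w does.
  set S : Set X := {x | condSq m μ u x * condSq m μ w x ≠ 0} with hS
  have mS : MeasurableSet[m] S :=
    ((measurable_condSq m μ u).mul (measurable_condSq m μ w))
      (measurableSet_singleton 0).compl
  have mh : Measurable[m] (S.indicator b) := mb.indicator mS
  have key : g₀ =ᵐ[μ] fun x => w x * S.indicator b x := by
    have lim_u : ∀ᵐ x ∂μ, condSq m μ u x = 0 → ∀ k, a k x = 0 := by
      have : ∀ᵐ x ∂μ, ∀ k, ‖a k x‖ₑ ^ 2 / condSq m μ u x ≤ 16 * condSq m μ (f (ns k)) x :=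
        ae_all_iff.2 fun k => sq_condE_div_le hm μ hu hF (hf (ns k))
      have fin : ∀ᵐ x ∂μ, ∀ k, condSq m μ (f (ns k)) x < ∞ :=
        ae_all_iff.2 fun k => condSq_coe_lt_top μ (f (ns k))
      filter_upwards [this, fin] with x h1 h2 h0 k
      by_contra hne
      have h3 := (h1 k).trans_lt (ENNReal.mul_lt_top (by norm_num) (h2 k))
      rw [h0, ENNReal.div_zero (by simpa using hne)] at h3
      exact lt_irrefl _ h3
    have hgf' : ∀ᵐ x ∂μ, ∀ k, g (ns k) x = w x * a k x := ae_all_iff.2 fun k => hgf (ns k)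
    filter_upwards [hns, hgf', lim_u, ae_eq_zero_of_condSq_eq_zero hm μ hw] with x h1 h2 h3 h4
    simp only [h2] at h1
    by_cases hx : w x = 0
    · simp only [hx, zero_mul] at h1 ⊢
      exact tendsto_nhds_unique h1 tendsto_const_nhds
    by_cases hu0 : condSq m μ u x = 0
    · simp only [h3 hu0, mul_zero] at h1
      have : x ∉ S := by simp [hS, hu0]
      rw [Set.indicator_of_notMem this, mul_zero]
      exact tendsto_nhds_unique h1 tendsto_const_nhds
    · have hxS : x ∈ S := mul_ne_zero hu0 fun k => hx (h4 k)
      have h5 : Tendsto (fun k => a k x) atTop (nhds (g₀ x / w x)) := by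
        refine (h1.div_const (w x)).congr fun k => ?_
        rw [mul_div_cancel_left₀ _ hx]
      rw [Set.indicator_of_mem hxS, hb]
      simp only
      rw [h5.limUnder_eq, mul_div_cancel₀ _ hx]
  refine mem_range_op_of_lintegral hm μ hu hF mh ?_ key
  have fin : ∫⁻ x, ‖S.indicator b x‖ₑ ^ 2 * condSq m μ w x ∂μ < ∞ := by
    rw [← lintegral_enorm_sq_mul hm μ hw mh]
    have := (memLp_two_iff_lintegral (Lp.aestronglyMeasurable g₀)).1 (Lp.memLp g₀)
    rwa [lintegral_congr_ae (g := fun x => ‖w x * S.indicator b x‖ₑ ^ 2)] at this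
    filter_upwards [key] with x hx
    rw [hx]
  have hr' : ENNReal.ofReal r ≠ 0 := (ENNReal.ofReal_pos.2 hr).ne'
  calc ∫⁻ x, ‖S.indicator b x‖ₑ ^ 2 / condSq m μ u x ∂μ
      ≤ ∫⁻ x, (ENNReal.ofReal r)⁻¹ * (‖S.indicator b x‖ₑ ^ 2 * condSq m μ w x) ∂μ := by
        refine lintegral_mono_ae ?_
        filter_upwards [h, hF] with x h1 h2
        by_cases hx : x ∈ S
        · have h3 := h1 hx
          have hu0 : condSq m μ u x ≠ 0 := left_ne_zero_of_mul hx
          -- The comparison of the two weights: 1/F ≤ r⁻¹G on S.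
          have h4 : (condSq m μ u x)⁻¹ ≤ (ENNReal.ofReal r)⁻¹ * condSq m μ w x := by
            calc (condSq m μ u x)⁻¹
                = (ENNReal.ofReal r)⁻¹ * ENNReal.ofReal r * (condSq m μ u x)⁻¹ := by
                  rw [ENNReal.inv_mul_cancel hr' ENNReal.ofReal_ne_top, one_mul]
              _ ≤ (ENNReal.ofReal r)⁻¹ * (condSq m μ u x * condSq m μ w x)
                  * (condSq m μ u x)⁻¹ := by gcongr
              _ = (ENNReal.ofReal r)⁻¹ * condSq m μ w x
                  * (condSq m μ u x * (condSq m μ u x)⁻¹) := by ring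
              _ = _ := by rw [ENNReal.mul_inv_cancel hu0 h2.ne, mul_one]
          rw [div_eq_mul_inv, mul_left_comm]
          gcongr
        · simp [Set.indicator_of_notMem hx]
    _ < ∞ := by
      rw [lintegral_const_mul' _ _ (ENNReal.inv_ne_top.2 hr')]
      exact ENNReal.mul_lt_top (ENNReal.inv_lt_top.2 (ENNReal.ofReal_pos.2 hr)) fin

/-! ### Closed range implies a lower bound. -/

/-- If the range is closed, every `w h` in `L²` with `h` measurable for the subalgebra and
supported in `{E(|u|²) ≠ 0}` belongs to it. -/
lemma mem_range_op_of_isClosed (hm : m ≤ m₀) (μ : Measure X) [SigmaFinite (μ.trim hm)]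
    {w u : X → ℂ} (hu : AEStronglyMeasurable u μ)
    (hF : ∀ᵐ x ∂μ, condSq m μ u x < ∞) (hcl : IsClosed (Set.range (op m μ w u)))
    {h : X → ℂ} (hh : Measurable[m] h) (h0 : ∀ x, condSq m μ u x = 0 → h x = 0)
    (hL : MemLp (fun x => w x * h x) 2 μ) : hL.toLp _ ∈ Set.range (op m μ w u) := by
  set q : X → ℝ≥0∞ := fun x => ‖h x‖ₑ ^ 2 / condSq m μ u x with hq
  have menorm : Measurable[m] fun x => ‖h x‖ₑ := measurable_enorm.comp hh
  have mq : Measurable[m] q := (menorm.pow_const 2).div (measurable_condSq m μ u)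
  have qfin (x) : q x < ∞ := by
    by_cases k : condSq m μ u x = 0
    · simp [hq, k, h0 x k]
    · exact ENNReal.div_lt_top (ENNReal.pow_lt_top enorm_lt_top).ne k
  -- On `A n` the quotient |h|²/E(|u|²) is at most n and the measure is finite, so the truncation
  -- has an explicit preimage. The truncations converge to wh in L², dominated by |wh|.
  set A : ℕ → Set X := fun n => spanningSets (μ.trim hm) n ∩ {x | q x ≤ n} with hA
  have mA (n) : MeasurableSet[m] (A n) :=
    (measurableSet_spanningSets (μ.trim hm) n).inter (mq measurableSet_Iic)
  have Amem (x) : ∀ᶠ n in atTop, x ∈ A n := by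
    obtain ⟨i, hi⟩ := Set.mem_iUnion.1 ((iUnion_spanningSets (μ.trim hm)).ge (Set.mem_univ x))
    obtain ⟨j, hj⟩ := ENNReal.exists_nat_gt (qfin x).ne
    filter_upwards [eventually_ge_atTop i, eventually_ge_atTop j] with n h1 h2
    exact ⟨monotone_spanningSets _ h1 hi, hj.le.trans (by exact_mod_cast h2)⟩
  have hLn (n) : MemLp (fun x => w x * (A n).indicator h x) 2 μ := by
    have := hL.indicator (hm _ (mA n))
    simpa only [← Set.indicator_mul_right] using this
  refine hcl.mem_of_tendsto (f := fun n => (hLn n).toLp _) (b := atTop) ?_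
    (Eventually.of_forall fun n => ?_)
  · rw [Lp.tendsto_Lp_iff_tendsto_eLpNorm'']
    have e2 : ∀ v : X → ℂ, eLpNorm v 2 μ = (∫⁻ x, ‖v x‖ₑ ^ 2 ∂μ) ^ (1 / 2 : ℝ) := fun v => by
      rw [eLpNorm_eq_lintegral_rpow_enorm_toReal (by norm_num) (by norm_num)]
      simp
    simp only [e2]
    have lim : Tendsto (fun n => ∫⁻ x, ‖((fun x => w x * (A n).indicator h x)
        - fun x => w x * h x) x‖ₑ ^ 2 ∂μ) atTop (nhds (∫⁻ _, 0 ∂μ)) := by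
      refine tendsto_lintegral_of_dominated_convergence' (fun x => ‖w x * h x‖ₑ ^ 2)
        (fun n => ((hLn n).1.sub hL.1).enorm.pow_const 2) (fun n => ae_of_all _ fun x => ?_)
        ((memLp_two_iff_lintegral hL.1).1 hL).ne (ae_of_all _ fun x => ?_)
      · by_cases hx : x ∈ A n <;> simp [hx]
      · refine tendsto_const_nhds.congr' ?_
        filter_upwards [Amem x] with n hn
        simp [hn]
    rw [lintegral_zero] at lim
    have := (ENNReal.continuous_rpow_const (y := (1 / 2 : ℝ))).tendsto 0 |>.comp lim
    simpa [Function.comp_def] using this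
  · refine mem_range_op_of_lintegral hm μ hu hF (hh.indicator (mA n)) ?_ (hLn n).coeFn_toLp
    calc ∫⁻ x, ‖(A n).indicator h x‖ₑ ^ 2 / condSq m μ u x ∂μ
        ≤ ∫⁻ x, (spanningSets (μ.trim hm) n).indicator (fun _ => (n : ℝ≥0∞)) x ∂μ := by
          refine lintegral_mono fun x => ?_
          by_cases hx : x ∈ A n
          · simp only [hx, Set.indicator_of_mem, hx.1]
            exact hx.2
          · simp [hx]
      _ < ∞ := by
        rw [lintegral_indicator_const (hm _ (measurableSet_spanningSets (μ.trim hm) n))]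
        exact ENNReal.mul_lt_top (ENNReal.natCast_lt_top n)
          (measure_spanningSets_trim_lt_top hm μ n)

/-- If the range is closed, `1 / (E(|u|²) E(|w|²))` is integrable against every integrable
function that is measurable for the subalgebra and supported in `{E(|u|²) E(|w|²) ≠ 0}`. -/
lemma lintegral_div_lt_top_of_isClosed (hm : m ≤ m₀) (μ : Measure X) [SigmaFinite (μ.trim hm)]
    {w u : X → ℂ} (hw : AEStronglyMeasurable w μ) (hu : AEStronglyMeasurable u μ)
    (hF : ∀ᵐ x ∂μ, condSq m μ u x < ∞) (hG : ∀ᵐ x ∂μ, condSq m μ w x < ∞)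
    (hcl : IsClosed (Set.range (op m μ w u))) {ψ : X → ℝ≥0∞} (hψ : Measurable[m] ψ)
    (h0 : ∀ x, condSq m μ u x * condSq m μ w x = 0 → ψ x = 0) (hi : ∫⁻ x, ψ x ∂μ < ∞) :
    ∫⁻ x, ψ x / (condSq m μ u x * condSq m μ w x) ∂μ < ∞ := by
  have mG := measurable_condSq m μ w
  -- Chosen so that |h|²G ≤ ψ, which puts wh in L², and |h|²/F = ψ/(FG).
  set h : X → ℂ := fun x => ((Real.sqrt (ψ x / condSq m μ w x).toReal : ℝ) : ℂ) with hdef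
  have hh : Measurable[m] h :=
    Complex.measurable_ofReal.comp (hψ.div mG).ennreal_toReal.sqrt
  have hsq : ∀ᵐ x ∂μ, ‖h x‖ₑ ^ 2 = ψ x / condSq m μ w x := by
    filter_upwards [ae_lt_top (hψ.mono hm le_rfl) hi.ne] with x hx
    have fin : ψ x / condSq m μ w x ≠ ∞ := by
      by_cases k : condSq m μ w x = 0
      · simp [k, h0 x (by simp [k])]
      · exact (ENNReal.div_lt_top hx.ne k).ne
    rw [hdef, ← ofReal_norm, Complex.norm_real, Real.norm_of_nonneg (Real.sqrt_nonneg _),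
      ← ENNReal.ofReal_pow (Real.sqrt_nonneg _), Real.sq_sqrt ENNReal.toReal_nonneg,
      ENNReal.ofReal_toReal fin]
  have hL : MemLp (fun x => w x * h x) 2 μ := by
    have mwh : AEStronglyMeasurable (fun x => w x * h x) μ :=
      hw.mul (hh.mono hm le_rfl).aestronglyMeasurable
    rw [memLp_two_iff_lintegral mwh, lintegral_enorm_sq_mul hm μ hw hh]
    refine lt_of_le_of_lt (lintegral_mono_ae ?_) hi
    filter_upwards [hsq] with x hx
    rw [hx]
    rw [mul_comm]
    exact ENNReal.mul_div_le
  obtain ⟨f, hf, hfg⟩ := mem_range_op_iff.1 (mem_range_op_of_isClosed hm μ hu hF hcl hh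
    (fun x hx => by simp [hdef, h0 x (by simp [hx])]) hL)
  set a := condE m μ fun y => u y * f y with ha
  -- Cancelling w gives a = h only where w ≠ 0; since {a = h} belongs to the subalgebra, the
  -- equality spreads to {E(|w|²) ≠ 0}.
  have eq : ∀ᵐ x ∂μ, condSq m μ w x ≠ 0 → x ∈ {x | a x = h x} := by
    refine ae_mem_of_condSq_ne_zero hm μ hw
      (measurableSet_eq_fun (measurable_condE m μ _) hh) ?_
    filter_upwards [hL.coeFn_toLp, hfg] with x h1 h2 hx
    rw [h1] at h2
    exact (mul_left_cancel₀ hx h2).symm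
  have hfi := (memLp_two_iff_lintegral (Lp.aestronglyMeasurable f)).1 (Lp.memLp f)
  calc ∫⁻ x, ψ x / (condSq m μ u x * condSq m μ w x) ∂μ
      ≤ ∫⁻ x, 16 * condSq m μ f x ∂μ := by
        refine lintegral_mono_ae ?_
        filter_upwards [eq, hsq, sq_condE_div_le hm μ hu hF hf, hG, hF] with x h1 h2 h3 h4 h5
        by_cases k : condSq m μ w x = 0
        · simp [h0 x (by simp [k])]
        · change ‖a x‖ₑ ^ 2 / _ ≤ _ at h3
          rw [show a x = h x from h1 k, h2] at h3
          refine le_trans (le_of_eq ?_) h3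
          rw [div_eq_mul_inv, div_eq_mul_inv, div_eq_mul_inv,
            ENNReal.mul_inv (Or.inr h4.ne) (Or.inl h5.ne)]
          ring
    _ < ∞ := by
      rw [lintegral_const_mul' _ _ (by norm_num), condSq, lintegral_condLExp hm]
      exact ENNReal.mul_lt_top (by norm_num) hfi

/-- If the range is closed, then `E(|u|²) E(|w|²)` is bounded below on its support. -/
lemma exists_le_of_isClosed (hm : m ≤ m₀) (μ : Measure X) [SigmaFinite (μ.trim hm)]
    {w u : X → ℂ} (hw : AEStronglyMeasurable w μ) (hu : AEStronglyMeasurable u μ)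
    (hF : ∀ᵐ x ∂μ, condSq m μ u x < ∞) (hG : ∀ᵐ x ∂μ, condSq m μ w x < ∞)
    (hcl : IsClosed (Set.range (op m μ w u))) :
    ∃ r : ℝ, 0 < r ∧ ∀ᵐ x ∂μ, condSq m μ u x * condSq m μ w x ≠ 0 →
      ENNReal.ofReal r ≤ condSq m μ u x * condSq m μ w x := by
  by_contra hcon
  set H : X → ℝ≥0∞ := fun x => condSq m μ u x * condSq m μ w x with hH
  have mH : Measurable[m] H := (measurable_condSq m μ u).mul (measurable_condSq m μ w)
  set ε : ℕ → ℝ≥0∞ := fun k => 2⁻¹ ^ k with hε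
  have ε0 (k) : ε k ≠ 0 := pow_ne_zero _ (by norm_num)
  have εtop (k) : ε k ≠ ∞ := ENNReal.pow_ne_top (by norm_num)
  have ex (k : ℕ) : ∃ B, MeasurableSet[m] B ∧ (∀ x ∈ B, H x ≠ 0 ∧ H x < ε k) ∧
      0 < μ B ∧ μ B < ∞ := by
    have mS : MeasurableSet[m] {x | H x ≠ 0 ∧ H x < ε k} :=
      (mH (measurableSet_singleton 0).compl).inter (mH measurableSet_Iio)
    -- If this set were null, r = 2⁻ᵏ would be a lower bound. Working with the trimmed measure keeps
    -- the subset B of finite measure inside the subalgebra.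
    have pos : 0 < μ.trim hm {x | H x ≠ 0 ∧ H x < ε k} := by
      rw [trim_measurableSet_eq hm mS, pos_iff_ne_zero]
      intro hz
      refine hcon ⟨(ε k).toReal, ENNReal.toReal_pos (ε0 k) (εtop k), ?_⟩
      filter_upwards [measure_eq_zero_iff_ae_notMem.1 hz] with x hx hne
      rw [ENNReal.ofReal_toReal (εtop k)]
      by_contra! hlt
      exact hx ⟨hne, hlt⟩
    obtain ⟨B, mB, hB, h1, h2⟩ := Measure.exists_subset_measure_lt_top mS pos
    rw [trim_measurableSet_eq hm mB] at h1 h2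
    exact ⟨B, mB, hB, h1, h2⟩
  choose B mB hB Bpos Bfin using ex
  -- The weights give ∫ ψ = ∑ 2⁻ᵏ = 2, whereas H < 2⁻ᵏ on `B k` makes each term contribute at least
  -- 1 to ∫ ψ/H. The sets need not be disjoint.
  set ψ : X → ℝ≥0∞ := fun x => ∑' k, (B k).indicator (fun _ => ε k / μ (B k)) x with hψ
  have mψk (k) : Measurable[m] ((B k).indicator fun _ => ε k / μ (B k)) :=
    Measurable.indicator measurable_const (mB k)
  have mψ : Measurable[m] ψ := measurable_tsum mψk
  have iψ : ∫⁻ x, ψ x ∂μ < ∞ := by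
    rw [lintegral_tsum fun k => ((mψk k).mono hm le_rfl).aemeasurable]
    simp only [lintegral_indicator_const (hm _ (mB _)),
      ENNReal.div_mul_cancel (Bpos _).ne' (Bfin _).ne, hε, ENNReal.tsum_geometric]
    norm_num
  have h0 : ∀ x, H x = 0 → ψ x = 0 := fun x hx => by
    simp only [hψ, ENNReal.tsum_eq_zero]
    exact fun k => Set.indicator_of_notMem (fun hk => (hB k x hk).1 hx) _
  refine (lintegral_div_lt_top_of_isClosed hm μ hw hu hF hG hcl mψ h0 iψ).ne ?_
  change ∫⁻ x, ψ x / H x ∂μ = ∞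
  rw [eq_top_iff]
  calc (∞ : ℝ≥0∞) = ∑' _ : ℕ, 1 := (ENNReal.tsum_const_eq_top_of_ne_zero one_ne_zero).symm
    _ = ∑' k, ∫⁻ x, (B k).indicator (fun _ => (μ (B k))⁻¹) x ∂μ := by
      refine tsum_congr fun k => ?_
      rw [lintegral_indicator_const (hm _ (mB k)),
        ENNReal.inv_mul_cancel (Bpos k).ne' (Bfin k).ne]
    _ = ∫⁻ x, ∑' k, (B k).indicator (fun _ => (μ (B k))⁻¹) x ∂μ :=
      (lintegral_tsum fun k =>
        (Measurable.indicator measurable_const (hm _ (mB k))).aemeasurable).symm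
    _ ≤ ∫⁻ x, ψ x / H x ∂μ := by
      refine lintegral_mono fun x => ?_
      simp only [hψ, div_eq_mul_inv]
      rw [← ENNReal.tsum_mul_right]
      refine ENNReal.tsum_le_tsum fun k => ?_
      by_cases hx : x ∈ B k
      · simp only [hx, Set.indicator_of_mem]
        rw [mul_right_comm]
        refine (one_mul _).ge.trans (mul_le_mul_left ?_ _)
        rw [← ENNReal.mul_inv_cancel (ε0 k) (εtop k)]
        gcongr
        exact (hB k x hx).2.le
      · simp [hx]

end WCT

theorem theorem2p8 {X : Type*} {m m₀ : MeasurableSpace X} (hm : m ≤ m₀) (μ : Measure X)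
    [SigmaFinite μ] [SigmaFinite (μ.trim hm)] (w u : X → ℂ)
    (hw : WCT.Conditionable m μ w) (hu : WCT.Conditionable m μ u)
    (hdense : Dense ((WCT.op m μ w u).domain : Set (Lp ℂ 2 μ)))
    (hstar : WCT.Star μ) :
    IsClosed (Set.range (WCT.op m μ w u)) ↔
      ∃ r : ℝ, 0 < r ∧ ∀ᵐ x ∂μ,
        WCT.condSq m μ u x * WCT.condSq m μ w x ≠ 0 →
          ENNReal.ofReal r ≤ WCT.condSq m μ u x * WCT.condSq m μ w x := by
  have hF := hstar.condSq_lt_top hm hu.1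
  have hG := hstar.condSq_lt_top hm hw.1
  exact ⟨WCT.exists_le_of_isClosed hm μ hw.1 hu.1 hF hG, fun ⟨_, hr, h⟩ =>
    WCT.isClosed_range_op hm μ hw.1 hu.1 hF hr h⟩
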